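/- Let $r,n\ge 0$, $\Lambda=(\lambda_1,\dots,\lambda_r)$, $\mathbf{x}=(x_1,\dots,x_n)$. Let $\le^\rho$ be a total order on $\mathbb{Z}^{n+r}$ (equivalently, on the group of Laurent monomials in $\Lambda,\mathbf{x}$) compatible with the additive group structure, and let $\le^{\bar\rho}$ be the reversed order. Let $\mathbb{C}^\rho\ll\Lambda,\mathbf{x}\gg$ be the field of Malcev–Neumann series, i.e. formal series with complex coefficients in Laurent monomials in $\Lambda,\mathbf{x}$ whose support is well-ordered for $\le^\rho$; the field $\mathbb{C}(\Lambda,\mathbf{x})$ embeds in it. For a set $S$ of variables, $\mathrm{CT}^\rho_S F$ denotes the constant term in the variables of $S$ of the expansion of the rational function $F$ in $\mathbb{C}^\rho\ll\Lambda,\mathbf{x}\gg$ (the sum of the terms in which no variable of $S$ occurs), regarded as a rational function whenever it is the expansion of one; similarly for $\bar\rho$. For $\lambda=\lambda_j$ let $K_j$ be the field of rational functions over $\mathbb{C}$ in all the variables other than $\lambda_j$, let $\mathrm{CT}_{\lambda=0}F$ and $\mathrm{CT}_{\lambda=\infty}F$ be the constant terms in $\lambda$ of the expansions of $F$ in $K_j((\lambda))$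 and $K_j((\lambda^{-1}))$, and put $\mathcal{I}_\lambda F=\mathrm{CT}_{\lambda=0}F+\mathrm{CT}_{\lambda=\infty}F$. **Theorem.** Let $F(\Lambda,\mathbf{x})$ be Elliott-rational, i.e. $F=p/\prod_{k=1}^m(y_k-z_k)$ with $p$ a polynomial over $\mathbb{C}$ in $\Lambda,\mathbf{x}$ and $y_k\ne z_k$ monomials. Then all the constant terms with respect to $\rho$ and $\bar\rho$ in the following formula are (expansions of) rational functions, and in $\mathbb{C}(\Lambda,\mathbf{x})$ $$\mathrm{CT}^{\bar\rho}_{\Lambda}F=(-1)^r\,\mathrm{CT}^{\rho}_{\Lambda}F+\sum_{i=0}^{r-1}(-1)^i\,\mathrm{CT}^{\bar\rho}_{\lambda_r,\dots,\lambda_{i+2}}\;\mathcal{I}_{\lambda_{i+1}}\;\mathrm{CT}^{\rho}_{\lambda_i,\dots,\lambda_1}F,$$ where $\mathrm{CT}^{\rho}_{\lambda_i,\dots,\lambda_1}$ is the identity for $i=0$ and $\mathrm{CT}^{\bar\rho}_{\lambda_r,\dots,\lambda_{i+2}}$ is the identity for $i=r-1$. -/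

import Mathlib

namespace MalcevNeumann

/-- The additive group `ℤ^σ` of exponent vectors of Laurent monomials in variables indexed by `σ`
(a synonym of `σ → ℤ`, so that the pointwise order is not in force). -/
def Expo (σ : Type) : Type := σ → ℤ

instance (σ : Type) : AddCommGroup (Expo σ) := inferInstanceAs (AddCommGroup (σ → ℤ))

/-- A total order on `ℤ^σ` (equivalently, on the group of Laurent monomials) that is compatible
with the group structure. -/
structure MonOrder (σ : Type) where
  order : LinearOrder (Expo σ)
  add_le_add : ∀ a b c : Expo σ, order.le a b → order.le (a + c) (b + c)

/-- The reversed order: `a ≤ b` for `ρ.rev` iff `b ≤ a` for `ρ`. -/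
noncomputable def MonOrder.rev {σ : Type} (ρ : MonOrder σ) : MonOrder σ where
  order :=
    { le := fun a b => ρ.order.le b a
      le_refl := fun a => ρ.order.le_refl a
      le_trans := fun a b c hab hbc => ρ.order.le_trans c b a hbc hab
      le_antisymm := fun a b hab hba => ρ.order.le_antisymm a b hba hab
      le_total := fun a b => ρ.order.le_total b a
      toDecidableLE := fun a b => ρ.order.toDecidableLE b a }
  add_le_add := fun a b c h => ρ.add_le_add b a c h

/-- The group `ℤ^σ` ordered by `ρ`. -/
def OrdMon {σ : Type} (_ρ : MonOrder σ) : Type := Expo σ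

instance {σ : Type} (ρ : MonOrder σ) : AddCommGroup (OrdMon ρ) :=
  inferInstanceAs (AddCommGroup (Expo σ))

instance {σ : Type} (ρ : MonOrder σ) : LinearOrder (OrdMon ρ) := ρ.order

instance {σ : Type} (ρ : MonOrder σ) : IsOrderedAddMonoid (OrdMon ρ) where
  add_le_add_left a b h c := ρ.add_le_add a b c h

/-- The field of Malcev-Neumann series: formal series over `ℂ` in Laurent monomials whose support
is well-ordered for `ρ`. -/
abbrev MNSeries {σ : Type} (ρ : MonOrder σ) : Type := HahnSeries (OrdMon ρ) ℂ

/-- The field `ℂ(σ)` of rational functions in the variables indexed by `σ`. -/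
abbrev RatFun (σ : Type) : Type := FractionRing (MvPolynomial σ ℂ)

/-- The exponent vector of the variable `v`. -/
noncomputable def unitExp {σ : Type} (ρ : MonOrder σ) (v : σ) : OrdMon ρ :=
  open Classical in (Pi.single v 1 : σ → ℤ)

/-- A polynomial as a Malcev-Neumann series (with finite support). -/
noncomputable def polyToMN {σ : Type} (ρ : MonOrder σ) : MvPolynomial σ ℂ →ₐ[ℂ] MNSeries ρ :=
  MvPolynomial.aeval fun v => HahnSeries.single (unitExp ρ v) (1 : ℂ)

/-- Nonnegative exponents as integer exponents. -/
def expCast {σ : Type} (ρ : MonOrder σ) (m : σ →₀ ℕ) : OrdMon ρ := fun v => (m v : ℤ)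

theorem expCast_injective {σ : Type} (ρ : MonOrder σ) : Function.Injective (expCast ρ) := by
  intro m m' h
  ext v
  have h' : (m v : ℤ) = (m' v : ℤ) := congrFun h v
  exact_mod_cast h'

theorem expCast_add {σ : Type} (ρ : MonOrder σ) (m m' : σ →₀ ℕ) :
    expCast ρ (m + m') = expCast ρ m + expCast ρ m' := by
  funext v
  change (((m + m') v : ℕ) : ℤ) = (m v : ℤ) + (m' v : ℤ)
  simp

theorem expCast_single {σ : Type} (ρ : MonOrder σ) (v : σ) :
    expCast ρ (Finsupp.single v 1) = unitExp ρ v := by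
  classical
  funext w
  simp only [expCast, unitExp]
  by_cases h : w = v
  · subst h; simp
  · simp [h]

theorem polyToMN_monomial {σ : Type} (ρ : MonOrder σ) (m : σ →₀ ℕ) (c : ℂ) :
    polyToMN ρ (MvPolynomial.monomial m c) = HahnSeries.single (expCast ρ m) c := by
  induction m using Finsupp.induction_linear generalizing c with
  | zero =>
    have : expCast ρ (0 : σ →₀ ℕ) = 0 := rfl
    rw [this]
    exact (polyToMN ρ).commutes c
  | add f g hf hg =>
    have : MvPolynomial.monomial (f + g) c
        = MvPolynomial.monomial f c * MvPolynomial.monomial g 1 := by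
      rw [MvPolynomial.monomial_mul, mul_one]
    rw [this, map_mul, hf, hg, expCast_add, HahnSeries.single_mul_single, mul_one]
  | single v k =>
    induction k generalizing c with
    | zero =>
      have : expCast ρ (Finsupp.single v 0 : σ →₀ ℕ) = 0 := by
        rw [Finsupp.single_zero]; rfl
      rw [this, Finsupp.single_zero]
      exact (polyToMN ρ).commutes c
    | succ k ih =>
      have : MvPolynomial.monomial (Finsupp.single v (k + 1)) c
          = MvPolynomial.monomial (Finsupp.single v k) c * MvPolynomial.X v := by
        rw [MvPolynomial.X, MvPolynomial.monomial_mul, mul_one, ← Finsupp.single_add]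
      rw [this, map_mul, ih, Finsupp.single_add, expCast_add, expCast_single]
      simp [polyToMN, HahnSeries.single_mul_single]

theorem polyToMN_coeff {σ : Type} (ρ : MonOrder σ) (p : MvPolynomial σ ℂ) (m : σ →₀ ℕ) :
    (polyToMN ρ p).coeff (expCast ρ m) = p.coeff m := by
  classical
  induction p using MvPolynomial.induction_on' with
  | monomial u a =>
    rw [polyToMN_monomial, HahnSeries.coeff_single, MvPolynomial.coeff_monomial]
    simp [(expCast_injective ρ).eq_iff, eq_comm]
  | add p q hp hq => simp [hp, hq]

theorem polyToMN_injective {σ : Type} (ρ : MonOrder σ) : Function.Injective (polyToMN ρ) := by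
  intro p q h
  ext m
  rw [← polyToMN_coeff ρ, ← polyToMN_coeff ρ, h]

/-- The expansion of rational functions into Malcev-Neumann series for `ρ`: the unique
extension of `polyToMN` to a ring homomorphism on the field of rational functions. -/
noncomputable def expand {σ : Type} (ρ : MonOrder σ) : RatFun σ →+* MNSeries ρ :=
  IsFractionRing.lift (g := (polyToMN ρ : MvPolynomial σ ℂ →+* MNSeries ρ))
    (polyToMN_injective ρ)

/-- The constant term of a Malcev-Neumann series in the set `S` of variables: keep the terms in
which no variable of `S` occurs. -/
noncomputable def ctSeries {σ : Type} {ρ : MonOrder σ} (S : Set σ) (f : MNSeries ρ) :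
    MNSeries ρ where
  coeff m := open Classical in if ∀ v ∈ S, (m : σ → ℤ) v = 0 then f.coeff m else 0
  isPWO_support' := f.isPWO_support.mono (by
    intro m hm
    simp only [Function.mem_support, ne_eq, ite_eq_right_iff, Classical.not_imp] at hm
    exact hm.2)

theorem ctSeries_empty {σ : Type} {ρ : MonOrder σ} (f : MNSeries ρ) :
    ctSeries ∅ f = f := by
  ext m
  simp [ctSeries]

/-- Constant terms in sets of variables are obtained by iteration. -/
theorem ctSeries_ctSeries {σ : Type} {ρ : MonOrder σ} (S T : Set σ) (f : MNSeries ρ) :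
    ctSeries S (ctSeries T f) = ctSeries (S ∪ T) f := by
  classical
  ext m
  simp only [ctSeries, Set.mem_union, or_imp, forall_and]
  split_ifs <;> tauto

/-- The constant term of the `ρ`-expansion of `F` in the variables of `S` is the `ρ`-expansion
of a rational function. -/
def HasRatCT {σ : Type} (ρ : MonOrder σ) (S : Set σ) (F : RatFun σ) : Prop :=
  ∃ G : RatFun σ, expand ρ G = ctSeries S (expand ρ F)

open Classical in
/-- The constant term of `F` in the variables of `S` with respect to `ρ`, as a rational function.
It is meaningful when `HasRatCT ρ S F` holds (and then uniquely determined, as `expand ρ` is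
injective); the default value is `0`. -/
noncomputable def CT {σ : Type} (ρ : MonOrder σ) (S : Set σ) (F : RatFun σ) : RatFun σ :=
  if h : HasRatCT ρ S F then h.choose else 0

/-- The field `K` of rational functions in all the variables other than `v`. -/
abbrev CoeffField {σ : Type} (v : σ) : Type := RatFun {w : σ // w ≠ v}

/-- The inclusion of `K` in the field of all rational functions. -/
noncomputable def coeffIncl {σ : Type} (v : σ) : CoeffField v →+* RatFun σ :=
  IsFractionRing.map (A := MvPolynomial {w : σ // w ≠ v} ℂ) (B := MvPolynomial σ ℂ)
    (j := ((MvPolynomial.rename Subtype.val :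
      MvPolynomial {w : σ // w ≠ v} ℂ →ₐ[ℂ] MvPolynomial σ ℂ) : _ →+* _))
    (MvPolynomial.rename_injective _ Subtype.val_injective)

open Classical in
/-- A polynomial as a Laurent series over `K` in an indeterminate `t`, where the variable `v`
becomes `t` (for `ε = 1`) or `t⁻¹` (for `ε = -1`). -/
noncomputable def polyToLaurent {σ : Type} (v : σ) (ε : ℤˣ) :
    MvPolynomial σ ℂ →+* LaurentSeries (CoeffField v) :=
  MvPolynomial.eval₂Hom
    ((HahnSeries.C : CoeffField v →+* LaurentSeries (CoeffField v)).comp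
      ((algebraMap (MvPolynomial {w : σ // w ≠ v} ℂ) (CoeffField v)).comp MvPolynomial.C))
    (fun w =>
      if h : w = v then HahnSeries.single (ε : ℤ) 1
      else HahnSeries.C (algebraMap (MvPolynomial {w : σ // w ≠ v} ℂ) (CoeffField v)
        (MvPolynomial.X ⟨w, h⟩)))

theorem polyToLaurent_C {σ : Type} (v : σ) (ε : ℤˣ) (c : ℂ) :
    polyToLaurent v ε (MvPolynomial.C c) =
      HahnSeries.single 0 (algebraMap (MvPolynomial {w : σ // w ≠ v} ℂ) (CoeffField v)
        (MvPolynomial.C c)) := by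
  simp only [polyToLaurent, MvPolynomial.coe_eval₂Hom, MvPolynomial.eval₂_C]
  rfl

theorem polyToLaurent_monomial {σ : Type} (v : σ) (ε : ℤˣ) (m : σ →₀ ℕ) (c : ℂ) :
    polyToLaurent v ε (MvPolynomial.monomial m c) =
      HahnSeries.single ((ε : ℤ) * (m v : ℤ))
        (algebraMap (MvPolynomial {w : σ // w ≠ v} ℂ) (CoeffField v)
          (MvPolynomial.monomial (m.subtypeDomain (· ≠ v)) c)) := by
  classical
  induction m using Finsupp.induction_linear generalizing c with
  | zero =>
    have := polyToLaurent_C v ε c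
    rw [MvPolynomial.C_apply, MvPolynomial.C_apply] at this
    rw [this]
    simp
  | add f g hf hg =>
    have : MvPolynomial.monomial (f + g) c
        = MvPolynomial.monomial f c * MvPolynomial.monomial g 1 := by
      rw [MvPolynomial.monomial_mul, mul_one]
    rw [this, map_mul, hf, hg, HahnSeries.single_mul_single, ← map_mul,
      MvPolynomial.monomial_mul, mul_one, Finsupp.subtypeDomain_add, Finsupp.add_apply]
    congr 1
    push_cast
    ring_nf
  | single w k =>
    induction k generalizing c with
    | zero =>
      have := polyToLaurent_C v ε c
      rw [MvPolynomial.C_apply, MvPolynomial.C_apply] at this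
      rw [Finsupp.single_zero, this]
      simp
    | succ k ih =>
      have : MvPolynomial.monomial (Finsupp.single w (k + 1)) c
          = MvPolynomial.monomial (Finsupp.single w k) c * MvPolynomial.X w := by
        rw [MvPolynomial.X, MvPolynomial.monomial_mul, mul_one, ← Finsupp.single_add]
      rw [this, map_mul, ih]
      by_cases h : w = v
      · subst h
        have h1 : ∀ j : ℕ, (Finsupp.single w j).subtypeDomain (· ≠ w) = 0 := by
          intro j
          ext ⟨u, hu⟩
          simp [Ne.symm hu]
        simp only [h1, Finsupp.single_eq_same, polyToLaurent, MvPolynomial.coe_eval₂Hom, MvPolynomial.eval₂_X, dite_true,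
          HahnSeries.single_mul_single, mul_one]
        congr 1
        push_cast
        ring_nf
      · have h1 : ∀ j : ℕ, (Finsupp.single w j).subtypeDomain (· ≠ v)
            = Finsupp.single (⟨w, h⟩ : {w : σ // w ≠ v}) j := by
          intro j
          ext ⟨u, hu⟩
          simp [Finsupp.single_apply]
        have h2 : ∀ j : ℕ, (Finsupp.single w j) v = 0 := by
          intro j
          simp [h]
        simp only [h1, h2, polyToLaurent, MvPolynomial.coe_eval₂Hom, MvPolynomial.eval₂_X, dif_neg h, HahnSeries.C_apply,
          HahnSeries.single_mul_single, ← map_mul]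
        rw [MvPolynomial.X, MvPolynomial.monomial_mul, mul_one, ← Finsupp.single_add]
        simp

theorem polyToLaurent_coeff {σ : Type} (v : σ) (ε : ℤˣ) (p : MvPolynomial σ ℂ) (k : ℕ) :
    ∃ q : MvPolynomial {w : σ // w ≠ v} ℂ,
      (polyToLaurent v ε p).coeff ((ε : ℤ) * (k : ℤ)) = algebraMap _ (CoeffField v) q ∧
      ∀ m : σ →₀ ℕ, m v = k → q.coeff (m.subtypeDomain (· ≠ v)) = p.coeff m := by
  classical
  induction p using MvPolynomial.induction_on' with
  | monomial u a =>
    rw [polyToLaurent_monomial]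
    by_cases h : u v = k
    · refine ⟨MvPolynomial.monomial (u.subtypeDomain (· ≠ v)) a, by simp [h], ?_⟩
      intro m hm
      rw [MvPolynomial.coeff_monomial, MvPolynomial.coeff_monomial]
      have : u.subtypeDomain (· ≠ v) = m.subtypeDomain (· ≠ v) ↔ u = m := by
        refine ⟨fun e => ?_, fun e => by rw [e]⟩
        ext w
        by_cases hw : w = v
        · rw [hw, h, hm]
        · exact DFunLike.congr_fun e ⟨w, hw⟩
      simp [this]
    · refine ⟨0, ?_, ?_⟩
      · rw [HahnSeries.coeff_single_of_ne, map_zero]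
        intro e
        have := mul_left_cancel₀ (Units.ne_zero ε) e
        exact h (by exact_mod_cast this.symm)
      · intro m hm
        rw [MvPolynomial.coeff_monomial, if_neg, MvPolynomial.coeff_zero]
        rintro rfl
        exact h hm
  | add p q hp hq =>
    obtain ⟨p', hp1, hp2⟩ := hp
    obtain ⟨q', hq1, hq2⟩ := hq
    refine ⟨p' + q', by simp [hp1, hq1], fun m hm => ?_⟩
    rw [MvPolynomial.coeff_add, MvPolynomial.coeff_add, hp2 m hm, hq2 m hm]

theorem polyToLaurent_injective {σ : Type} (v : σ) (ε : ℤˣ) :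
    Function.Injective (polyToLaurent v ε) := by
  rw [injective_iff_map_eq_zero]
  intro p hp
  ext m
  obtain ⟨q, hq1, hq2⟩ := polyToLaurent_coeff v ε p (m v)
  rw [hp, HahnSeries.coeff_zero] at hq1
  have hq : q = 0 := (IsFractionRing.injective (MvPolynomial {w : σ // w ≠ v} ℂ)
    (CoeffField v)) (by rw [map_zero]; exact hq1.symm)
  rw [← hq2 m rfl, hq, MvPolynomial.coeff_zero, MvPolynomial.coeff_zero]

/-- The expansion of a rational function as a Laurent series over `K` in `v` (for `ε = 1`)
or in `v⁻¹` (for `ε = -1`). -/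
noncomputable def laurentExpand {σ : Type} (v : σ) (ε : ℤˣ) :
    RatFun σ →+* LaurentSeries (CoeffField v) :=
  IsFractionRing.lift (A := MvPolynomial σ ℂ) (K := RatFun σ) (L := LaurentSeries (CoeffField v))
    (g := polyToLaurent v ε) (polyToLaurent_injective v ε)

/-- The constant term in `v` of the expansion of `F` in `K((v))`. -/
noncomputable def CTZero {σ : Type} (v : σ) (F : RatFun σ) : RatFun σ :=
  coeffIncl v ((laurentExpand v 1 F).coeff 0)

/-- The constant term in `v` of the expansion of `F` in `K((v⁻¹))`. -/
noncomputable def CTInfty {σ : Type} (v : σ) (F : RatFun σ) : RatFun σ :=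
  coeffIncl v ((laurentExpand v (-1) F).coeff 0)

/-- The operator `𝓘_v = CT_{v = 0} + CT_{v = ∞}`. -/
noncomputable def invCT {σ : Type} (v : σ) (F : RatFun σ) : RatFun σ :=
  CTZero v F + CTInfty v F

/-- The Laurent monomial with exponent vector `a`, as a rational function. -/
noncomputable def laurentMonomial {σ : Type} [Fintype σ] (a : σ → ℤ) : RatFun σ :=
  ∏ w, algebraMap (MvPolynomial σ ℂ) (RatFun σ) (MvPolynomial.X w) ^ a w

/-- Elliott-rational functions: a polynomial divided by a finite product of nonzero differences of
two monomials. -/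
def IsElliottRational {σ : Type} [Fintype σ] (F : RatFun σ) : Prop :=
  ∃ (p : MvPolynomial σ ℂ) (m : ℕ) (y z : Fin m → σ → ℤ), (∀ i, y i ≠ z i) ∧
    F = algebraMap (MvPolynomial σ ℂ) (RatFun σ) p /
      ∏ i, (laurentMonomial (y i) - laurentMonomial (z i))

/-- The set of the variables `λ_j` with `j ∈ S`, among the variables `λ_1, …, λ_r` (indexed by
`Fin r`) and `x_1, …, x_n` (indexed by `Fin n`). -/
def lambdaVars {r : ℕ} (n : ℕ) (S : Set (Fin r)) : Set (Fin r ⊕ Fin n) := Sum.inl '' S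

end MalcevNeumann

/-! Everything takes place in the ring `ellRing Set.univ` generated by the constants, the Laurent
monomials `M` and the inverses of the `1 - M`. It contains the Elliott-rational functions, since `y
- z = y (1 - z / y)`. The central claim (`hasInvolutiveCT_of_mem_ellRing`) is that for `F` in this
ring and a single variable `v`, the constant terms of `F` in `v` for `ρ` and for the reversed order
again lie in this ring, and their sum is `invCT v F`. Closure of the ring is what permits iteration
over several variables.

For the claim, flip factors so that every monomial `M` in a denominator `1 - M` is positive for `ρ`;
then `1 / (1 - M)` expands geometrically. Sort these factors by the sign of the degree of `M` in
`v`. Factors of opposite sign are coprime over the Laurent polynomials in `v`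
(`coprimeIn_denominators`), so `F` is a sum of two fractions, each with factors of one sign `ε`. For
such a fraction the constant term for `ρ` is the one at `v = 0` if `ε = 1` and at `v = ∞` if `ε =
-1` (`hasRegularCT_mul_laurentMonomial_mul_inv`). Passing to the reversed order flips every factor,
hence also `ε`, so the other order gives the other end, and the two add up to `invCT v`.

The theorem then telescopes: the `i`-th summand splits into two mixed constant terms, in which the
first `i`, respectively `i + 1`, variables are treated by `ρ` and the rest by the reversed order. -/

namespace MalcevNeumann

/-! ### Hahn series: monomials and division by `1 - u t ^ a` -/

section HahnSeries

variable {Γ K : Type*} [AddCommGroup Γ] [LinearOrder Γ] [IsOrderedAddMonoid Γ] [Field K]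

theorem single_zpow (a : Γ) (u : K) (k : ℤ) :
    (HahnSeries.single a u) ^ k = HahnSeries.single (k • a) (u ^ k) := by
  cases k with
  | ofNat k => simp [HahnSeries.single_pow]
  | negSucc k =>
    rw [zpow_negSucc, zpow_negSucc, HahnSeries.single_pow, HahnSeries.inv_single, negSucc_zsmul]

theorem prod_single {ι : Type*} (s : Finset ι) (f : ι → Γ) (u : ι → K) :
    ∏ i ∈ s, HahnSeries.single (f i) (u i) = HahnSeries.single (∑ i ∈ s, f i) (∏ i ∈ s, u i) := by
  classical
  induction s using Finset.induction_on with
  | empty => simp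
  | insert i s hi ih =>
    rw [Finset.prod_insert hi, Finset.sum_insert hi, Finset.prod_insert hi, ih,
      HahnSeries.single_mul_single]

/-- If `(1 - u t ^ a) f = g` with `a > 0`, then `f` vanishes on every set that is stable under
subtraction of `a` and on which `g` vanishes. -/
theorem coeff_eq_zero_of_one_sub_single_mul {f g : HahnSeries Γ K} {a : Γ} {u : K} (ha : 0 < a)
    (hfg : (1 - HahnSeries.single a u) * f = g) {U : Set Γ} (hU : ∀ m ∈ U, m - a ∈ U)
    (hg : ∀ m ∈ U, g.coeff m = 0) : ∀ m ∈ U, f.coeff m = 0 := by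
  by_contra! hne
  obtain ⟨m₀, hm₀, hm₀'⟩ := hne
  -- At the least exponent `m` of `f` in `U`, the relation `f_m = u f_(m - a) + g_m` with `g_m = 0`
  -- makes `m - a` a smaller one.
  have hwf : (f.support ∩ U).IsWF := f.isWF_support.mono Set.inter_subset_left
  have hnon : (f.support ∩ U).Nonempty := ⟨m₀, hm₀', hm₀⟩
  obtain ⟨h1, h2⟩ := hwf.min_mem hnon
  set m := hwf.min hnon
  have hf : f.coeff m - u * f.coeff (m - a) = g.coeff m := by
    rw [← hfg, sub_mul, one_mul, HahnSeries.coeff_sub, HahnSeries.coeff_single_mul]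
  have h3 : f.coeff (m - a) ≠ 0 := by
    intro h
    rw [h, mul_zero, sub_zero, hg m h2] at hf
    exact h1 hf
  exact hwf.not_lt_min hnon ⟨h3, hU m h2⟩ (sub_lt_self m ha)

end HahnSeries

/-! ### Values of the expansions, and series free of a variable -/

variable {σ : Type}

/-- The exponent of the variable `v`. -/
def degAt (ρ : MonOrder σ) (v : σ) : OrdMon ρ →+ ℤ := Pi.evalAddMonoidHom (fun _ : σ => ℤ) v

/-- An exponent vector as an element of the group ordered by `ρ`. -/
def toOrd (ρ : MonOrder σ) : (σ → ℤ) ≃+ OrdMon ρ := AddEquiv.refl (σ → ℤ)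

theorem degAt_toOrd (ρ : MonOrder σ) (v : σ) (a : σ → ℤ) : degAt ρ v (toOrd ρ a) = a v := rfl

theorem ordMon_ext {ρ : MonOrder σ} {a b : OrdMon ρ} (h : ∀ v, degAt ρ v a = degAt ρ v b) : a = b :=
  funext h

open Classical in
theorem degAt_unitExp (ρ : MonOrder σ) (v w : σ) :
    degAt ρ v (unitExp ρ w) = if v = w then 1 else 0 := by
  have h : degAt ρ v (unitExp ρ w) = (Pi.single w 1 : σ → ℤ) v := rfl
  rw [h, Pi.single_apply]

theorem expand_injective (ρ : MonOrder σ) : Function.Injective (expand ρ) := (expand ρ).injective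

theorem expand_algebraMap (ρ : MonOrder σ) (p : MvPolynomial σ ℂ) :
    expand ρ (algebraMap _ _ p) = polyToMN ρ p :=
  IsFractionRing.lift_algebraMap (polyToMN_injective ρ) p

theorem expand_X (ρ : MonOrder σ) (v : σ) :
    expand ρ (algebraMap (MvPolynomial σ ℂ) (RatFun σ) (MvPolynomial.X v)) =
        HahnSeries.single (unitExp ρ v) 1 := by
  rw [expand_algebraMap, polyToMN, MvPolynomial.aeval_X]

theorem expand_C (ρ : MonOrder σ) (c : ℂ) :
    expand ρ (algebraMap (MvPolynomial σ ℂ) (RatFun σ) (MvPolynomial.C c)) =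
        HahnSeries.single 0 c := by
  rw [expand_algebraMap]
  exact (polyToMN ρ).commutes c

theorem laurentExpand_algebraMap (v : σ) (ε : ℤˣ) (p : MvPolynomial σ ℂ) :
    laurentExpand v ε (algebraMap _ _ p) = polyToLaurent v ε p :=
  IsFractionRing.lift_algebraMap (polyToLaurent_injective v ε) p

theorem coeffIncl_algebraMap (v : σ) (p : MvPolynomial {w : σ // w ≠ v} ℂ) :
    coeffIncl v (algebraMap _ _ p) = algebraMap _ _ (MvPolynomial.rename Subtype.val p) := by
  exact IsLocalization.map_eq (M := nonZeroDivisors (MvPolynomial {w : σ // w ≠ v} ℂ))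
    (T := nonZeroDivisors (MvPolynomial σ ℂ))
    (nonZeroDivisors_le_comap_nonZeroDivisors_of_injective _
      (MvPolynomial.rename_injective _ Subtype.val_injective)) p

theorem laurentExpand_X_self (v : σ) (ε : ℤˣ) :
    laurentExpand v ε (algebraMap (MvPolynomial σ ℂ) (RatFun σ) (MvPolynomial.X v)) =
        HahnSeries.single (ε : ℤ) 1 := by
  rw [laurentExpand_algebraMap]
  simp [polyToLaurent]

theorem polyToLaurent_rename (v : σ) (ε : ℤˣ) (p : MvPolynomial {w : σ // w ≠ v} ℂ) :
    polyToLaurent v ε (MvPolynomial.rename Subtype.val p) =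
      HahnSeries.C (algebraMap _ (CoeffField v) p) := by
  induction p using MvPolynomial.induction_on with
  | C c => rw [MvPolynomial.rename_C, polyToLaurent_C, HahnSeries.C_apply]
  | add p q hp hq => rw [map_add, map_add, hp, hq, map_add, map_add]
  | mul_X p w hp =>
    rw [map_mul, map_mul, hp, MvPolynomial.rename_X, map_mul, map_mul]
    congr 1
    simp [polyToLaurent, w.2]

theorem laurentExpand_coeffIncl (v : σ) (ε : ℤˣ) (k : CoeffField v) :
    laurentExpand v ε (coeffIncl v k) = HahnSeries.C k := by
  obtain ⟨p, q, -, rfl⟩ := IsFractionRing.div_surjective (A := MvPolynomial {w : σ // w ≠ v} ℂ) k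
  rw [map_div₀, map_div₀, map_div₀, coeffIncl_algebraMap, coeffIncl_algebraMap,
    laurentExpand_algebraMap, laurentExpand_algebraMap, polyToLaurent_rename, polyToLaurent_rename]

/-- The series in which the variable `v` does not occur. -/
def degZeroSeries (ρ : MonOrder σ) (v : σ) : Subring (MNSeries ρ) where
  carrier := {f | ∀ m, degAt ρ v m ≠ 0 → f.coeff m = 0}
  zero_mem' m _ := rfl
  one_mem' m hm := by
    rw [HahnSeries.coeff_one, if_neg]
    rintro rfl
    exact hm (map_zero _)
  add_mem' {f g} hf hg m hm := by rw [HahnSeries.coeff_add, hf m hm, hg m hm, add_zero]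
  neg_mem' {f} hf m hm := by rw [HahnSeries.coeff_neg, hf m hm, neg_zero]
  mul_mem' {f g} hf hg m hm := by
    rw [HahnSeries.coeff_mul]
    refine Finset.sum_eq_zero fun ij hij => ?_
    rw [Finset.mem_antidiagonal] at hij
    by_cases h1 : degAt ρ v ij.1 = 0
    · have h2 : degAt ρ v ij.2 ≠ 0 := by
        rwa [← hij.2.2, map_add, h1, zero_add] at hm
      rw [hg _ h2, mul_zero]
    · rw [hf _ h1, zero_mul]

theorem single_mem_degZeroSeries {ρ : MonOrder σ} {v : σ} {a : OrdMon ρ} (ha : degAt ρ v a = 0)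
    (c : ℂ) : HahnSeries.single a c ∈ degZeroSeries ρ v := by
  intro m hm
  rw [HahnSeries.coeff_single_of_ne]
  rintro rfl
  exact hm ha

theorem ctSeries_add {ρ : MonOrder σ} (S : Set σ) (f g : MNSeries ρ) :
    ctSeries S (f + g) = ctSeries S f + ctSeries S g := by
  ext m
  simp only [ctSeries, HahnSeries.coeff_add]
  split_ifs <;> simp

theorem ctSeries_neg {ρ : MonOrder σ} (S : Set σ) (f : MNSeries ρ) :
    ctSeries S (-f) = -ctSeries S f := by
  ext m
  simp only [ctSeries, HahnSeries.coeff_neg]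
  split_ifs <;> simp

theorem ctSeries_singleton_of_mem {ρ : MonOrder σ} {v : σ} {f : MNSeries ρ}
    (hf : f ∈ degZeroSeries ρ v) : ctSeries {v} f = f := by
  ext m
  by_cases h : degAt ρ v m = 0
  · simp only [ctSeries, Set.mem_singleton_iff, forall_eq]
    exact if_pos h
  · rw [hf m h]
    simp only [ctSeries, Set.mem_singleton_iff, forall_eq]
    exact if_neg h

theorem ctSeries_singleton_eq_zero {ρ : MonOrder σ} {v : σ} {f : MNSeries ρ}
    (hf : ∀ m, degAt ρ v m = 0 → f.coeff m = 0) : ctSeries {v} f = 0 := by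
  ext m
  simp only [ctSeries, Set.mem_singleton_iff, forall_eq, HahnSeries.coeff_zero, ite_eq_right_iff]
  exact hf m

theorem ne_zero_of_toOrd_pos {ρ : MonOrder σ} {a : σ → ℤ} (h : 0 < toOrd ρ a) : a ≠ 0 := by
  rintro rfl
  exact h.ne (map_zero _).symm

/-! ### Laurent monomials and their expansions -/

section Monomials

theorem algebraMap_X_ne_zero (w : σ) : algebraMap (MvPolynomial σ ℂ) (RatFun σ)
    (MvPolynomial.X w) ≠ 0 := by
  simp

variable [Fintype σ]

theorem laurentMonomial_zero : laurentMonomial (0 : σ → ℤ) = 1 := by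
  simp [laurentMonomial]

theorem laurentMonomial_add (a b : σ → ℤ) :
    laurentMonomial (a + b) = laurentMonomial a * laurentMonomial b := by
  simp only [laurentMonomial, ← Finset.prod_mul_distrib]
  exact Finset.prod_congr rfl fun w _ => zpow_add₀ (algebraMap_X_ne_zero w) _ _

theorem laurentMonomial_neg (a : σ → ℤ) :
    laurentMonomial (-a) = (laurentMonomial a)⁻¹ := by
  simp [laurentMonomial]

theorem laurentMonomial_nsmul (k : ℕ) (a : σ → ℤ) :
    laurentMonomial (k • a) = laurentMonomial a ^ k := by
  induction k with
  | zero => rw [zero_smul, laurentMonomial_zero, pow_zero]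
  | succ k ih => rw [succ_nsmul, laurentMonomial_add, ih, pow_succ]

theorem expand_laurentMonomial (ρ : MonOrder σ) (a : σ → ℤ) :
    expand ρ (laurentMonomial a) = HahnSeries.single (toOrd ρ a) 1 := by
  classical
  have h : ∑ w, a w • unitExp ρ w = toOrd ρ a := by
    refine ordMon_ext fun v => ?_
    rw [map_sum, degAt_toOrd]
    simp [map_zsmul, degAt_unitExp]
  unfold laurentMonomial
  rw [map_prod]
  simp only [map_zpow₀, expand_X, single_zpow, prod_single, one_zpow, Finset.prod_const_one]
  rw [h]

theorem laurentExpand_laurentMonomial (v : σ) (ε : ℤˣ) (a : σ → ℤ) :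
    ∃ u, laurentExpand v ε (laurentMonomial a) = HahnSeries.single ((ε : ℤ) * a v) u := by
  classical
  have hX : ∀ w : σ, ∃ u, laurentExpand v ε (algebraMap (MvPolynomial σ ℂ) (RatFun σ)
      (MvPolynomial.X w)) =
      HahnSeries.single (if w = v then (ε : ℤ) else 0) u := by
    intro w
    by_cases h : w = v
    · subst h
      exact ⟨1, by rw [laurentExpand_X_self, if_pos rfl]⟩
    · refine ⟨algebraMap (MvPolynomial {w : σ // w ≠ v} ℂ) (CoeffField v)
        (MvPolynomial.X ⟨w, h⟩), ?_⟩
      rw [laurentExpand_algebraMap, if_neg h, ← HahnSeries.C_apply, ← polyToLaurent_rename,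
        MvPolynomial.rename_X]
  choose u hu using hX
  refine ⟨∏ w, u w ^ a w, ?_⟩
  unfold laurentMonomial
  rw [map_prod]
  simp only [map_zpow₀, hu, single_zpow, prod_single]
  congr 1
  simp [mul_comm]

theorem laurentMonomial_mem_range_coeffIncl {v : σ} {a : σ → ℤ} (ha : a v = 0) :
    laurentMonomial a ∈ (coeffIncl v).fieldRange := by
  unfold laurentMonomial
  refine prod_mem fun w _ => ?_
  by_cases h : w = v
  · rw [h, ha, zpow_zero]
    exact one_mem _
  · have hX : algebraMap (MvPolynomial σ ℂ) (RatFun σ) (MvPolynomial.X w) ∈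
        (coeffIncl v).fieldRange := by
      rw [RingHom.mem_fieldRange]
      refine ⟨algebraMap (MvPolynomial {w : σ // w ≠ v} ℂ) (CoeffField v)
          (MvPolynomial.X ⟨w, h⟩), ?_⟩
      rw [coeffIncl_algebraMap, MvPolynomial.rename_X]
    exact zpow_mem hX _

theorem one_sub_laurentMonomial_ne_zero {a : σ → ℤ} (ρ : MonOrder σ) (ha : a ≠ 0) :
    1 - laurentMonomial a ≠ 0 := by
  intro h
  have h1 : HahnSeries.single (toOrd ρ a) (1 : ℂ) = 1 := by
    rw [← expand_laurentMonomial, ← sub_eq_zero.1 h, map_one]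
  have h2 := congrArg (fun f => HahnSeries.coeff f (toOrd ρ a)) h1
  simp only [HahnSeries.coeff_single_same, HahnSeries.coeff_one] at h2
  rw [if_neg ((map_ne_zero_iff _ (toOrd ρ).injective).2 ha)] at h2
  exact one_ne_zero h2

end Monomials

end MalcevNeumann

/-! ### The ring of Elliott functions and its elements free of `v` -/

namespace MalcevNeumann

variable {σ : Type} [Fintype σ]

/-- The ring generated by the constants, the monomials `M` with exponents in `T`, and the
inverses of the differences `1 - M`. -/
noncomputable def ellRing (T : Set (σ → ℤ)) : Subring (RatFun σ) :=
  Subring.closure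
    (Set.range (fun c : ℂ => algebraMap (MvPolynomial σ ℂ) (RatFun σ) (MvPolynomial.C c)) ∪
      (laurentMonomial '' T ∪ (fun a => (1 - laurentMonomial a)⁻¹) '' T))

theorem ellRing_mono {T T' : Set (σ → ℤ)} (h : T ⊆ T') : ellRing T ≤ ellRing T' := by
  unfold ellRing
  gcongr

theorem C_mem_ellRing (T : Set (σ → ℤ)) (c : ℂ) :
    algebraMap (MvPolynomial σ ℂ) (RatFun σ) (MvPolynomial.C c) ∈ ellRing T :=
  Subring.subset_closure (Or.inl ⟨c, rfl⟩)

theorem laurentMonomial_mem_ellRing {T : Set (σ → ℤ)} {a : σ → ℤ} (ha : a ∈ T) :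
    laurentMonomial a ∈ ellRing T :=
  Subring.subset_closure (Or.inr (Or.inl ⟨a, ha, rfl⟩))

theorem inv_one_sub_mem_ellRing {T : Set (σ → ℤ)} {a : σ → ℤ} (ha : a ∈ T) :
    (1 - laurentMonomial a)⁻¹ ∈ ellRing T :=
  Subring.subset_closure (Or.inr (Or.inr ⟨a, ha, rfl⟩))

/-- This flip trades a monomial for its inverse: it makes the monomials of denominators positive for
`ρ`, and later carries denominators over to the reversed order. -/
theorem inv_one_sub_laurentMonomial {ρ : MonOrder σ} {a : σ → ℤ} (ha : a ≠ 0) :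
    (1 - laurentMonomial a)⁻¹ = -1 * laurentMonomial (-a) * (1 - laurentMonomial (-a))⁻¹ := by
  have h1 := one_sub_laurentMonomial_ne_zero ρ ha
  have h2 := one_sub_laurentMonomial_ne_zero ρ (neg_ne_zero.2 ha)
  have h3 : laurentMonomial a * laurentMonomial (-a) = 1 := by
    rw [← laurentMonomial_add, add_neg_cancel, laurentMonomial_zero]
  field_simp
  linear_combination -h3

theorem expand_one_sub_laurentMonomial (ρ : MonOrder σ) (a : σ → ℤ) :
    expand ρ (1 - laurentMonomial a) = 1 - HahnSeries.single (toOrd ρ a) 1 := by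
  rw [map_sub, map_one, expand_laurentMonomial]

/-- The elements without `v`: the exponents of their generators do not involve `v`. -/
noncomputable abbrev coeffRing (v : σ) : Subring (RatFun σ) := ellRing {a | a v = 0}

theorem mem_range_coeffIncl {v : σ} {F : RatFun σ} (hF : F ∈ coeffRing v) :
    ∃ k, coeffIncl v k = F := by
  suffices h : coeffRing v ≤ (coeffIncl v).fieldRange.toSubring from
    RingHom.mem_fieldRange.1 (h hF)
  refine Subring.closure_le.2 ?_
  rintro _ (⟨c, rfl⟩ | ⟨a, ha, rfl⟩ | ⟨a, ha, rfl⟩)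
  · refine RingHom.mem_fieldRange.2
      ⟨algebraMap (MvPolynomial {w : σ // w ≠ v} ℂ) (CoeffField v) (MvPolynomial.C c), ?_⟩
    rw [coeffIncl_algebraMap, MvPolynomial.rename_C]
  · exact laurentMonomial_mem_range_coeffIncl ha
  · exact (coeffIncl v).fieldRange.inv_mem
      (sub_mem (one_mem _) (laurentMonomial_mem_range_coeffIncl ha))

/-- Only the generators `(1 - M)⁻¹` need an argument. If `M` is positive for `ρ`, the exponents that
involve `v` are stable under subtraction of that of `M`, so the vanishing principle for division by
`1 - M` applies; otherwise flip first. -/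
theorem expand_mem_degZeroSeries (ρ : MonOrder σ) {v : σ} {F : RatFun σ} (hF : F ∈ coeffRing v) :
    expand ρ F ∈ degZeroSeries ρ v := by
  suffices h : coeffRing v ≤ (degZeroSeries ρ v).comap (expand ρ) from h hF
  have hmon : ∀ a : σ → ℤ, a v = 0 → expand ρ (laurentMonomial a) ∈ degZeroSeries ρ v := by
    intro a ha
    rw [expand_laurentMonomial]
    exact single_mem_degZeroSeries ha 1
  have hpos : ∀ a : σ → ℤ, a v = 0 → 0 < toOrd ρ a →
      expand ρ (1 - laurentMonomial a)⁻¹ ∈ degZeroSeries ρ v := by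
    intro a ha hlt
    have ha0 : a ≠ 0 := by rintro rfl; exact hlt.ne (map_zero _).symm
    have h : (1 - HahnSeries.single (toOrd ρ a) 1) * expand ρ (1 - laurentMonomial a)⁻¹ = 1 := by
      rw [← expand_one_sub_laurentMonomial, ← map_mul,
        mul_inv_cancel₀ (one_sub_laurentMonomial_ne_zero ρ ha0), map_one]
    refine coeff_eq_zero_of_one_sub_single_mul (U := {m | degAt ρ v m ≠ 0}) hlt h ?_
      (one_mem (degZeroSeries ρ v))
    intro m hm
    rwa [Set.mem_ofPred_eq, map_sub, degAt_toOrd, ha, sub_zero]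
  refine Subring.closure_le.2 ?_
  rintro _ (⟨c, rfl⟩ | ⟨a, ha, rfl⟩ | ⟨a, ha, rfl⟩)
  · rw [SetLike.mem_coe, Subring.mem_comap, expand_C]
    exact single_mem_degZeroSeries (map_zero _) c
  · exact hmon a ha
  · rw [SetLike.mem_coe, Subring.mem_comap]
    rcases lt_trichotomy 0 (toOrd ρ a) with h | h | h
    · exact hpos a ha h
    · obtain rfl : a = 0 := (toOrd ρ).injective (h.symm.trans (map_zero _).symm)
      simp [laurentMonomial_zero]
    · have ha0 : a ≠ 0 := by rintro rfl; exact h.ne (map_zero _)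
      have ha' : (-a) v = 0 := neg_eq_zero.2 ha
      change expand ρ (1 - laurentMonomial a)⁻¹ ∈ degZeroSeries ρ v
      rw [inv_one_sub_laurentMonomial (ρ := ρ) ha0, map_mul, map_mul, map_neg, map_one]
      refine mul_mem (mul_mem (neg_mem (one_mem _)) (hmon _ ha')) (hpos _ ha' ?_)
      rwa [map_neg, neg_pos]

theorem expand_mul_laurentMonomial_coeff {ρ : MonOrder σ} {v : σ} {c : RatFun σ}
    (hc : c ∈ coeffRing v) (e : σ → ℤ) {m : OrdMon ρ} (hm : degAt ρ v m ≠ e v) :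
    (expand ρ (c * laurentMonomial e)).coeff m = 0 := by
  rw [mul_comm, map_mul, expand_laurentMonomial, HahnSeries.coeff_single_mul, one_mul]
  refine expand_mem_degZeroSeries ρ hc _ ?_
  rwa [map_sub, degAt_toOrd, sub_ne_zero]

theorem laurentExpand_mul_laurentMonomial_coeff {v : σ} (ε : ℤˣ) {c : RatFun σ}
    (hc : c ∈ coeffRing v) (e : σ → ℤ) {k : ℤ} (hk : k ≠ ε * e v) :
    (laurentExpand v ε (c * laurentMonomial e)).coeff k = 0 := by
  obtain ⟨c, rfl⟩ := mem_range_coeffIncl hc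
  obtain ⟨u, hu⟩ := laurentExpand_laurentMonomial v ε e
  rw [map_mul, laurentExpand_coeffIncl, hu, HahnSeries.C_apply, HahnSeries.single_mul_single,
    zero_add, HahnSeries.coeff_single_of_ne hk]

/-! ### One-sided denominators: the constant term for `ρ` is taken at `0` or at `∞` -/

/-- The constant term of `F` in `v` with respect to `ρ` is that of the expansion of `F` at
`v = 0` (for `ε = 1`) or at `v = ∞` (for `ε = -1`). -/
def HasRegularCT (ρ : MonOrder σ) (v : σ) (ε : ℤˣ) (F : RatFun σ) : Prop :=
  ∃ G ∈ ellRing Set.univ, expand ρ G = ctSeries {v} (expand ρ F) ∧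
    coeffIncl v ((laurentExpand v ε F).coeff 0) = G

theorem HasRegularCT.add {ρ : MonOrder σ} {v : σ} {ε : ℤˣ} {F F' : RatFun σ}
    (h : HasRegularCT ρ v ε F) (h' : HasRegularCT ρ v ε F') : HasRegularCT ρ v ε (F + F') := by
  obtain ⟨G, hG, h1, h2⟩ := h
  obtain ⟨G', hG', h1', h2'⟩ := h'
  refine ⟨G + G', add_mem hG hG', ?_, ?_⟩
  · rw [map_add, map_add, ctSeries_add, h1, h1']
  · rw [map_add, HahnSeries.coeff_add, map_add, h2, h2']

/-- Both expansions are concentrated in the single degree `e v` of `v`: in degree zero the function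
is its own constant term, otherwise both constant terms vanish. -/
theorem hasRegularCT_mul_laurentMonomial (ρ : MonOrder σ) {v : σ} (ε : ℤˣ) {c : RatFun σ}
    (hc : c ∈ coeffRing v) (e : σ → ℤ) : HasRegularCT ρ v ε (c * laurentMonomial e) := by
  by_cases he : e v = 0
  · have hF := mul_mem hc (laurentMonomial_mem_ellRing (T := {a | a v = 0}) he)
    refine ⟨_, ellRing_mono (Set.subset_univ _) hF,
      (ctSeries_singleton_of_mem (expand_mem_degZeroSeries ρ hF)).symm, ?_⟩
    obtain ⟨k, hk⟩ := mem_range_coeffIncl hF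
    rw [← hk, laurentExpand_coeffIncl, HahnSeries.C_apply, HahnSeries.coeff_single_same]
  · refine ⟨0, zero_mem _, ?_, ?_⟩
    · rw [map_zero, ctSeries_singleton_eq_zero]
      intro m hm
      exact expand_mul_laurentMonomial_coeff hc e (hm ▸ Ne.symm he)
    · rw [laurentExpand_mul_laurentMonomial_coeff ε hc e, map_zero]
      exact (mul_ne_zero (Units.ne_zero ε) he).symm

/-- The expansions of `F` with respect to `ρ` and in `v ^ ε` have positive exponents of `v ^ ε`
only. -/
def HasPositiveExpansion (ρ : MonOrder σ) (v : σ) (ε : ℤˣ) (F : RatFun σ) : Prop :=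
  (∀ m, ε * degAt ρ v m ≤ 0 → (expand ρ F).coeff m = 0) ∧
    ∀ k ≤ 0, (laurentExpand v ε F).coeff k = 0

theorem HasPositiveExpansion.hasRegularCT {ρ : MonOrder σ} {v : σ} {ε : ℤˣ} {F : RatFun σ}
    (h : HasPositiveExpansion ρ v ε F) : HasRegularCT ρ v ε F := by
  refine ⟨0, zero_mem _, ?_, ?_⟩
  · rw [map_zero, ctSeries_singleton_eq_zero]
    intro m hm
    exact h.1 m (by rw [hm, mul_zero])
  · rw [h.2 0 le_rfl, map_zero]

/-- The products of differences `1 - M`, for monomials `M` that are small for `ρ` and have positive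
degree in `v ^ ε`. -/
noncomputable def denominators (ρ : MonOrder σ) (v : σ) (ε : ℤˣ) : Submonoid (RatFun σ) :=
  Submonoid.closure ((fun a => 1 - laurentMonomial a) '' {a | 0 < toOrd ρ a ∧ 0 < ε * a v})

theorem denominators_ne_zero {ρ : MonOrder σ} {v : σ} {ε : ℤˣ} {d : RatFun σ}
    (hd : d ∈ denominators ρ v ε) : d ≠ 0 := by
  suffices h : denominators ρ v ε ≤ nonZeroDivisors (RatFun σ) from nonZeroDivisors.ne_zero (h hd)
  refine Submonoid.closure_le.2 ?_
  rintro _ ⟨a, ha, rfl⟩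
  exact mem_nonZeroDivisors_of_ne_zero
    (one_sub_laurentMonomial_ne_zero ρ (ne_zero_of_toOrd_pos ha.1))

/-- Nonpositive degrees in `v ^ ε` are stable under subtraction of the exponent of a factor's
monomial. That monomial is positive for `ρ` and in the `v ^ ε`-adic order alike, so one vanishing
principle serves both expansions. -/
theorem HasPositiveExpansion.mul_inv {ρ : MonOrder σ} {v : σ} {ε : ℤˣ} {d : RatFun σ}
    (hd : d ∈ denominators ρ v ε) {F : RatFun σ} (h : HasPositiveExpansion ρ v ε F) :
    HasPositiveExpansion ρ v ε (F * d⁻¹) := by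
  induction hd using Submonoid.closure_induction generalizing F with
  | one => simpa using h
  | mul x y _ _ hx hy =>
    rw [_root_.mul_inv, ← mul_assoc]
    exact hy (hx h)
  | mem d hd =>
    obtain ⟨a, ⟨ha, hav⟩, rfl⟩ := hd
    have hmul : (1 - laurentMonomial a) * (F * (1 - laurentMonomial a)⁻¹) = F := by
      have := one_sub_laurentMonomial_ne_zero ρ (ne_zero_of_toOrd_pos ha)
      field_simp
    constructor
    · refine coeff_eq_zero_of_one_sub_single_mul (U := {m | ε * degAt ρ v m ≤ 0})
        (g := expand ρ F) (u := 1) ha ?_ ?_ h.1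
      · rw [← expand_one_sub_laurentMonomial, ← map_mul, hmul]
      · intro m hm
        rw [Set.mem_ofPred_eq] at hm ⊢
        rw [map_sub, degAt_toOrd, mul_sub]
        linarith
    · obtain ⟨u, hu⟩ := laurentExpand_laurentMonomial v ε a
      refine coeff_eq_zero_of_one_sub_single_mul (U := {k | k ≤ 0})
        (g := laurentExpand v ε F) (u := u) hav ?_ ?_ h.2
      · rw [← hu, ← map_one (laurentExpand v ε), ← map_sub, ← map_mul, hmul]
      · intro k hk
        rw [Set.mem_ofPred_eq] at hk ⊢
        linarith

theorem hasPositiveExpansion_mul_laurentMonomial (ρ : MonOrder σ) {v : σ} {ε : ℤˣ} {c : RatFun σ}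
    (hc : c ∈ coeffRing v) {e : σ → ℤ} (he : 0 < ε * e v) :
    HasPositiveExpansion ρ v ε (c * laurentMonomial e) := by
  constructor
  · intro m hm
    refine expand_mul_laurentMonomial_coeff hc e fun h => ?_
    rw [h] at hm
    linarith
  · intro k hk
    exact laurentExpand_mul_laurentMonomial_coeff ε hc e (hk.trans_lt he).ne

/-- Unrolling the geometric series of one factor finitely often leaves terms with one factor fewer
and a remainder of positive degree in `v ^ ε`, whose constant terms vanish in both expansions. -/
theorem hasRegularCT_mul_laurentMonomial_mul_inv {ρ : MonOrder σ} {v : σ} {ε : ℤˣ} {c d : RatFun σ}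
    (hc : c ∈ coeffRing v) (hd : d ∈ denominators ρ v ε) (e : σ → ℤ) :
    HasRegularCT ρ v ε (c * laurentMonomial e * d⁻¹) := by
  induction hd using Submonoid.closure_induction_left generalizing e with
  | one => simpa using hasRegularCT_mul_laurentMonomial ρ ε hc e
  | mul_left x hx y hy ih =>
    have hxy : x * y ∈ denominators ρ v ε := mul_mem (Submonoid.subset_closure hx) hy
    obtain ⟨a, ⟨ha, hav⟩, rfl⟩ := hx
    have hy0 := denominators_ne_zero hy
    have hx0 := one_sub_laurentMonomial_ne_zero ρ (ne_zero_of_toOrd_pos ha)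
    -- The bound `n` counts the unrollings still needed to bring the degree `ε * e v` up to at least
    -- `1`.
    have key : ∀ (n : ℕ) (e : σ → ℤ), 1 - ε * e v ≤ n →
        HasRegularCT ρ v ε (c * laurentMonomial e * ((1 - laurentMonomial a) * y)⁻¹) := by
      intro n
      induction n with
      | zero =>
        intro e he
        refine (HasPositiveExpansion.mul_inv hxy
          (hasPositiveExpansion_mul_laurentMonomial ρ hc ?_)).hasRegularCT
        push_cast at he
        linarith
      | succ n ihn =>
        intro e he
        -- With `A = laurentMonomial a`, this is `1 / (1 - A) = 1 + A / (1 - A)`.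
        have hsplit : c * laurentMonomial e * ((1 - laurentMonomial a) * y)⁻¹ =
            c * laurentMonomial e * y⁻¹ +
              c * laurentMonomial (e + a) * ((1 - laurentMonomial a) * y)⁻¹ := by
          rw [laurentMonomial_add]
          field_simp
          ring
        rw [hsplit]
        refine (ih e).add (ihn (e + a) ?_)
        rw [Pi.add_apply, mul_add]
        push_cast at he
        linarith
    exact key (1 - ε * e v).toNat e (Int.self_le_toNat _)

end MalcevNeumann

/-! ### Reversing the order: the sum of the two constant terms -/

namespace MalcevNeumann

variable {σ : Type}

theorem toOrd_rev_neg_pos {ρ : MonOrder σ} {a : σ → ℤ} (ha : 0 < toOrd ρ a) :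
    0 < toOrd ρ.rev (-a) := by
  rw [← not_le] at ha ⊢
  intro h
  have h' : (0 : OrdMon ρ) ≤ toOrd ρ (-a) := h
  rw [map_neg, neg_nonneg] at h'
  exact ha h'

theorem invCT_add (v : σ) (F F' : RatFun σ) : invCT v (F + F') = invCT v F + invCT v F' := by
  simp only [invCT, CTZero, CTInfty, map_add, HahnSeries.coeff_add]
  ring

theorem invCT_neg (v : σ) (F : RatFun σ) : invCT v (-F) = -invCT v F := by
  simp only [invCT, CTZero, CTInfty, map_neg, HahnSeries.coeff_neg]
  ring

variable [Fintype σ]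

/-- Flipping every factor negates the exponents, which makes them positive for the reversed order
and changes the sign of their degrees in `v`. -/
theorem exists_inv_eq_of_mem_denominators {ρ : MonOrder σ} {v : σ} {ε : ℤˣ} {d : RatFun σ}
    (hd : d ∈ denominators ρ v ε) :
    ∃ c ∈ coeffRing v, ∃ e, ∃ d' ∈ denominators ρ.rev v (-ε),
      d⁻¹ = c * laurentMonomial e * d'⁻¹ := by
  induction hd using Submonoid.closure_induction with
  | one => exact ⟨1, one_mem _, 0, 1, one_mem _, by simp [laurentMonomial_zero]⟩
  | mul x y _ _ hx hy =>
    obtain ⟨c, hc, e, d, hd, h⟩ := hx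
    obtain ⟨c', hc', e', d', hd', h'⟩ := hy
    refine ⟨c * c', mul_mem hc hc', e + e', d * d', mul_mem hd hd', ?_⟩
    rw [mul_inv, h, h', laurentMonomial_add, mul_inv]
    ring
  | mem d hd =>
    obtain ⟨a, ⟨ha, hav⟩, rfl⟩ := hd
    refine ⟨-1, neg_mem (one_mem _), -a, _, Submonoid.subset_closure ⟨-a, ⟨?_, ?_⟩, rfl⟩,
      inv_one_sub_laurentMonomial (ρ := ρ) (ne_zero_of_toOrd_pos ha)⟩
    · exact toOrd_rev_neg_pos ha
    · simpa using hav

/-- The constant terms of `F` in `v` with respect to `ρ` and the reversed order are rational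
functions with sum `𝓘_v F`. -/
def HasInvolutiveCT (ρ : MonOrder σ) (v : σ) (F : RatFun σ) : Prop :=
  ∃ G ∈ ellRing Set.univ, ∃ G' ∈ ellRing Set.univ, expand ρ G = ctSeries {v} (expand ρ F) ∧
    expand ρ.rev G' = ctSeries {v} (expand ρ.rev F) ∧ invCT v F = G' + G

theorem HasInvolutiveCT.add {ρ : MonOrder σ} {v : σ} {F₁ F₂ : RatFun σ}
    (h₁ : HasInvolutiveCT ρ v F₁) (h₂ : HasInvolutiveCT ρ v F₂) :
    HasInvolutiveCT ρ v (F₁ + F₂) := by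
  obtain ⟨G₁, hG₁, G₁', hG₁', h₁, h₁', e₁⟩ := h₁
  obtain ⟨G₂, hG₂, G₂', hG₂', h₂, h₂', e₂⟩ := h₂
  refine ⟨G₁ + G₂, add_mem hG₁ hG₂, G₁' + G₂', add_mem hG₁' hG₂', ?_, ?_, ?_⟩
  · rw [map_add, map_add, ctSeries_add, h₁, h₂]
  · rw [map_add, map_add, ctSeries_add, h₁', h₂']
  · rw [invCT_add, e₁, e₂]
    ring

theorem HasInvolutiveCT.neg {ρ : MonOrder σ} {v : σ} {F : RatFun σ}
    (h : HasInvolutiveCT ρ v F) : HasInvolutiveCT ρ v (-F) := by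
  obtain ⟨G, hG, G', hG', h, h', e⟩ := h
  refine ⟨-G, neg_mem hG, -G', neg_mem hG', ?_, ?_, ?_⟩
  · rw [map_neg, map_neg, ctSeries_neg, h]
  · rw [map_neg, map_neg, ctSeries_neg, h']
  · rw [invCT_neg, e]
    ring

theorem hasInvolutiveCT_mul_laurentMonomial_mul_inv {ρ : MonOrder σ} {v : σ} {ε : ℤˣ}
    {c d : RatFun σ} (hc : c ∈ coeffRing v) (hd : d ∈ denominators ρ v ε) (e : σ → ℤ) :
    HasInvolutiveCT ρ v (c * laurentMonomial e * d⁻¹) := by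
  obtain ⟨G, hG, h1, h2⟩ := hasRegularCT_mul_laurentMonomial_mul_inv hc hd e
  obtain ⟨c', hc', f, d', hd', hdd'⟩ := exists_inv_eq_of_mem_denominators hd
  have hF : c * laurentMonomial e * d⁻¹ = c * c' * laurentMonomial (e + f) * d'⁻¹ := by
    rw [hdd', laurentMonomial_add]
    ring
  obtain ⟨G', hG', h1', h2'⟩ :=
    hasRegularCT_mul_laurentMonomial_mul_inv (mul_mem hc hc') hd' (e + f)
  rw [← hF] at h1' h2'
  refine ⟨G, hG, G', hG', h1, h1', ?_⟩
  rw [← h2, ← h2', invCT, CTZero, CTInfty]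
  -- The two constant terms are those at `v = 0` and `v = ∞`; `ε` only decides which belongs to `ρ`.
  rcases Int.units_eq_one_or ε with rfl | rfl
  · exact add_comm _ _
  · rw [neg_neg]

/-! ### Partial fractions in `v` -/

/-- The products of an element of `coeffRing v` and a monomial. -/
noncomputable def laurentTerms (v : σ) : Submonoid (RatFun σ) where
  carrier := {F | ∃ c ∈ coeffRing v, ∃ e, F = c * laurentMonomial e}
  one_mem' := ⟨1, one_mem _, 0, by rw [laurentMonomial_zero, mul_one]⟩
  mul_mem' := by
    rintro _ _ ⟨c, hc, e, rfl⟩ ⟨c', hc', e', rfl⟩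
    refine ⟨c * c', mul_mem hc hc', e + e', ?_⟩
    rw [laurentMonomial_add]
    ring

/-- The ring of Laurent polynomials in `v` over `coeffRing v`. -/
noncomputable def laurentRing (v : σ) : Subring (RatFun σ) := Subring.closure (laurentTerms v)

theorem coeff_mem_laurentRing {v : σ} {c : RatFun σ} (hc : c ∈ coeffRing v) : c ∈ laurentRing v :=
  Subring.subset_closure ⟨c, hc, 0, by rw [laurentMonomial_zero, mul_one]⟩

theorem laurentMonomial_mem_laurentRing (v : σ) (e : σ → ℤ) : laurentMonomial e ∈ laurentRing v :=
  Subring.subset_closure ⟨1, one_mem _, e, by rw [one_mul]⟩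

theorem mem_laurentRing_of_mem_denominators {ρ : MonOrder σ} {v : σ} {ε : ℤˣ} {d : RatFun σ}
    (hd : d ∈ denominators ρ v ε) : d ∈ laurentRing v := by
  suffices h : denominators ρ v ε ≤ (laurentRing v).toSubmonoid from h hd
  refine Submonoid.closure_le.2 ?_
  rintro _ ⟨a, -, rfl⟩
  change 1 - laurentMonomial a ∈ laurentRing v
  exact sub_mem (one_mem _) (laurentMonomial_mem_laurentRing v a)

theorem hasInvolutiveCT_mul_inv {ρ : MonOrder σ} {v : σ} {ε : ℤˣ}
    {p d : RatFun σ} (hp : p ∈ laurentRing v) (hd : d ∈ denominators ρ v ε) :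
    HasInvolutiveCT ρ v (p * d⁻¹) := by
  -- The terms already form a monoid, so the ring is their additive span and linearity in the
  -- numerator suffices.
  rw [laurentRing, Subring.mem_closure_iff, Submonoid.closure_eq] at hp
  induction hp using AddSubgroup.closure_induction with
  | mem p hp =>
    obtain ⟨c, hc, e, rfl⟩ := hp
    exact hasInvolutiveCT_mul_laurentMonomial_mul_inv hc hd e
  | zero => simpa using hasInvolutiveCT_mul_laurentMonomial_mul_inv (zero_mem (coeffRing v)) hd 0
  | add p q _ _ hp hq =>
    rw [add_mul]
    exact hp.add hq
  | neg p _ hp =>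
    rw [neg_mul]
    exact hp.neg

/-- Two elements of a ring that generate the unit ideal of a subring. -/
def CoprimeIn {R : Type*} [CommRing R] (P : Subring R) (a b : R) : Prop :=
  ∃ x ∈ P, ∃ y ∈ P, x * a + y * b = 1

theorem CoprimeIn.symm {R : Type*} [CommRing R] {P : Subring R} {a b : R}
    (h : CoprimeIn P a b) : CoprimeIn P b a := by
  obtain ⟨x, hx, y, hy, h⟩ := h
  exact ⟨y, hy, x, hx, by rw [add_comm, h]⟩

theorem CoprimeIn.mul_right {R : Type*} [CommRing R] {P : Subring R} {a b b' : R}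
    (ha : a ∈ P) (hb : b ∈ P) (hb' : b' ∈ P) (h : CoprimeIn P a b) (h' : CoprimeIn P a b') :
    CoprimeIn P a (b * b') := by
  obtain ⟨x, hx, y, hy, h⟩ := h
  obtain ⟨x', hx', y', hy', h'⟩ := h'
  refine ⟨x * x' * a + x * y' * b' + y * b * x', ?_, y * y', mul_mem hy hy', ?_⟩
  · exact add_mem (add_mem (mul_mem (mul_mem hx hx') ha) (mul_mem (mul_mem hx hy') hb'))
      (mul_mem (mul_mem hy hb) hx')
  · calc _ = (x * a + y * b) * (x' * a + y' * b') := by ring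
      _ = 1 := by rw [h, h', one_mul]

theorem coprimeIn_one_right {R : Type*} [CommRing R] (P : Subring R) (a : R) :
    CoprimeIn P a 1 := ⟨0, zero_mem _, 1, one_mem _, by ring⟩

/-- Let `A`, `B` be the monomials, of degrees `j` and `-k` in `v`. Then `A ^ k B ^ j` is free of
`v`, and is not `1` because it is positive for `ρ`; so `1 - A ^ k B ^ j = (1 - A ^ k) + A ^ k (1 - B
^ j)` is a unit of `coeffRing v` and a combination of `1 - A` and `1 - B`. -/
theorem coprimeIn_one_sub_laurentMonomial {ρ : MonOrder σ} {v : σ} {a b : σ → ℤ}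
    (ha : 0 < toOrd ρ a) (hb : 0 < toOrd ρ b) (hav : 0 < a v) (hbv : b v < 0) :
    CoprimeIn (laurentRing v) (1 - laurentMonomial a) (1 - laurentMonomial b) := by
  obtain ⟨j, hj⟩ := Int.eq_ofNat_of_zero_le hav.le
  obtain ⟨k, hk⟩ := Int.eq_ofNat_of_zero_le (neg_nonneg.2 hbv.le)
  have hj0 : j ≠ 0 := by omega
  have hk0 : k ≠ 0 := by omega
  have hpos : 0 < toOrd ρ (k • a + j • b) := by
    rw [map_add, map_nsmul, map_nsmul]
    exact add_pos (nsmul_pos ha hk0) (nsmul_pos hb hj0)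
  have hv : (k • a + j • b) v = 0 := by
    rw [Pi.add_apply, Pi.smul_apply, Pi.smul_apply, nsmul_eq_mul, nsmul_eq_mul, hj,
      show b v = -(k : ℤ) by omega]
    ring
  have hne := one_sub_laurentMonomial_ne_zero ρ (ne_zero_of_toOrd_pos hpos)
  have hw := coeff_mem_laurentRing (inv_one_sub_mem_ellRing (T := {a | a v = 0}) hv)
  have hsum : ∀ (e : σ → ℤ) (n : ℕ),
      ∑ i ∈ Finset.range n, laurentMonomial e ^ i ∈ laurentRing v := fun e n =>
    sum_mem fun i _ => pow_mem (laurentMonomial_mem_laurentRing v e) i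
  refine ⟨_, mul_mem hw (hsum a k), _,
    mul_mem (mul_mem hw (pow_mem (laurentMonomial_mem_laurentRing v a) k)) (hsum b j), ?_⟩
  rw [mul_assoc, mul_assoc, mul_assoc, ← mul_add, geom_sum_mul_neg, geom_sum_mul_neg]
  refine (inv_mul_eq_one₀ hne).2 ?_
  rw [laurentMonomial_add, laurentMonomial_nsmul, laurentMonomial_nsmul]
  ring

theorem coprimeIn_denominators {ρ : MonOrder σ} {v : σ} {d d' : RatFun σ}
    (hd : d ∈ denominators ρ v 1) (hd' : d' ∈ denominators ρ v (-1)) :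
    CoprimeIn (laurentRing v) d d' := by
  have hgen : ∀ a : σ → ℤ, 1 - laurentMonomial a ∈ laurentRing v := fun a =>
    sub_mem (one_mem _) (laurentMonomial_mem_laurentRing v a)
  induction hd' using Submonoid.closure_induction with
  | one => exact coprimeIn_one_right _ _
  | mul x y hx hy ihx ihy =>
    exact ihx.mul_right (mem_laurentRing_of_mem_denominators hd)
        (mem_laurentRing_of_mem_denominators hx)
      (mem_laurentRing_of_mem_denominators hy) ihy
  | mem d' hd' =>
    obtain ⟨b, ⟨hb, hbv⟩, rfl⟩ := hd'
    refine CoprimeIn.symm ?_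
    induction hd using Submonoid.closure_induction with
    | one => exact coprimeIn_one_right _ _
    | mul x y hx hy ihx ihy =>
      exact ihx.mul_right (hgen b) (mem_laurentRing_of_mem_denominators hx)
        (mem_laurentRing_of_mem_denominators hy) ihy
    | mem d hd =>
      obtain ⟨a, ⟨ha, hav⟩, rfl⟩ := hd
      exact (coprimeIn_one_sub_laurentMonomial ha hb (by simpa using hav)
        (by simpa using hbv)).symm

/-- The products of an element of `laurentRing v` and inverses of denominators. -/
def IsLaurentFraction (ρ : MonOrder σ) (v : σ) (F : RatFun σ) : Prop :=
  ∃ p ∈ laurentRing v, ∃ d ∈ denominators ρ v 1, ∃ d' ∈ denominators ρ v (-1),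
    F = p * (d⁻¹ * d'⁻¹)

theorem isLaurentFraction_of_mem (ρ : MonOrder σ) {v : σ} {F : RatFun σ}
    (hF : F ∈ laurentRing v) : IsLaurentFraction ρ v F :=
  ⟨F, hF, 1, one_mem _, 1, one_mem _, by simp⟩

theorem IsLaurentFraction.mul {ρ : MonOrder σ} {v : σ} {F F' : RatFun σ}
    (h : IsLaurentFraction ρ v F) (h' : IsLaurentFraction ρ v F') :
    IsLaurentFraction ρ v (F * F') := by
  obtain ⟨p, hp, d₁, hd₁, d₂, hd₂, rfl⟩ := h
  obtain ⟨p', hp', d₁', hd₁', d₂', hd₂', rfl⟩ := h'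
  refine ⟨p * p', mul_mem hp hp', _, mul_mem hd₁ hd₁', _, mul_mem hd₂ hd₂', ?_⟩
  rw [mul_inv, mul_inv]
  ring

theorem IsLaurentFraction.add {ρ : MonOrder σ} {v : σ} {F F' : RatFun σ}
    (h : IsLaurentFraction ρ v F) (h' : IsLaurentFraction ρ v F') :
    IsLaurentFraction ρ v (F + F') := by
  obtain ⟨p, hp, d₁, hd₁, d₂, hd₂, rfl⟩ := h
  obtain ⟨p', hp', d₁', hd₁', d₂', hd₂', rfl⟩ := h'
  refine ⟨p * (d₁' * d₂') + p' * (d₁ * d₂), ?_, _, mul_mem hd₁ hd₁', _, mul_mem hd₂ hd₂', ?_⟩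
  · exact add_mem
      (mul_mem hp (mul_mem (mem_laurentRing_of_mem_denominators hd₁')
        (mem_laurentRing_of_mem_denominators hd₂')))
      (mul_mem hp' (mul_mem (mem_laurentRing_of_mem_denominators hd₁)
        (mem_laurentRing_of_mem_denominators hd₂)))
  · have h₁ := denominators_ne_zero hd₁
    have h₂ := denominators_ne_zero hd₂
    have h₁' := denominators_ne_zero hd₁'
    have h₂' := denominators_ne_zero hd₂'
    field_simp

theorem isLaurentFraction_inv_of_pos {ρ : MonOrder σ} (v : σ) {a : σ → ℤ} (ha : 0 < toOrd ρ a) :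
    IsLaurentFraction ρ v (1 - laurentMonomial a)⁻¹ := by
  rcases lt_trichotomy 0 (a v) with h | h | h
  · exact ⟨1, one_mem _, _, Submonoid.subset_closure ⟨a, ⟨ha, by simpa using h⟩, rfl⟩,
      1, one_mem _, by simp⟩
  · exact isLaurentFraction_of_mem ρ (coeff_mem_laurentRing (inv_one_sub_mem_ellRing h.symm))
  · exact ⟨1, one_mem _, 1, one_mem _,
      _, Submonoid.subset_closure ⟨a, ⟨ha, by simpa using h⟩, rfl⟩, by simp⟩

/-- After a flip each `1 - M` has `M` positive for `ρ`. The sign of its degree in `v` decides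
whether it joins `d`, joins `d'`, or is absorbed by the coefficients. -/
theorem isLaurentFraction_of_mem_ellRing (ρ : MonOrder σ) (v : σ) {F : RatFun σ}
    (hF : F ∈ ellRing Set.univ) : IsLaurentFraction ρ v F := by
  induction hF using Subring.closure_induction with
  | zero => exact isLaurentFraction_of_mem ρ (zero_mem _)
  | one => exact isLaurentFraction_of_mem ρ (one_mem _)
  | add F F' _ _ h h' => exact h.add h'
  | mul F F' _ _ h h' => exact h.mul h'
  | neg F _ h =>
    rw [← neg_one_mul]
    exact (isLaurentFraction_of_mem ρ (neg_mem (one_mem _))).mul h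
  | mem F hF =>
    rcases hF with ⟨c, rfl⟩ | ⟨a, -, rfl⟩ | ⟨a, -, rfl⟩
    · exact isLaurentFraction_of_mem ρ (coeff_mem_laurentRing (C_mem_ellRing _ c))
    · exact isLaurentFraction_of_mem ρ (laurentMonomial_mem_laurentRing v a)
    · rcases lt_trichotomy 0 (toOrd ρ a) with h | h | h
      · exact isLaurentFraction_inv_of_pos v h
      · obtain rfl : a = 0 := (toOrd ρ).injective (h.symm.trans (map_zero _).symm)
        simpa [laurentMonomial_zero] using isLaurentFraction_of_mem ρ (zero_mem (laurentRing v))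
      · have ha0 : a ≠ 0 := by rintro rfl; exact h.ne (map_zero _)
        change IsLaurentFraction ρ v (1 - laurentMonomial a)⁻¹
        rw [inv_one_sub_laurentMonomial (ρ := ρ) ha0]
        refine (isLaurentFraction_of_mem ρ (mul_mem (neg_mem (one_mem _))
          (laurentMonomial_mem_laurentRing v _))).mul (isLaurentFraction_inv_of_pos v ?_)
        rwa [map_neg, neg_pos]

theorem hasInvolutiveCT_of_mem_ellRing (ρ : MonOrder σ) (v : σ) {F : RatFun σ}
    (hF : F ∈ ellRing Set.univ) : HasInvolutiveCT ρ v F := by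
  obtain ⟨p, hp, d, hd, d', hd', rfl⟩ := isLaurentFraction_of_mem_ellRing ρ v hF
  obtain ⟨x, hx, y, hy, hxy⟩ := coprimeIn_denominators hd hd'
  have h0 := denominators_ne_zero hd
  have h0' := denominators_ne_zero hd'
  -- Partial fractions: multiply the numerator by `1 = x * d + y * d'`.
  have hsplit : p * (d⁻¹ * d'⁻¹) = p * x * d'⁻¹ + p * y * d⁻¹ := by
    field_simp
    linear_combination (-p) * hxy
  rw [hsplit]
  exact (hasInvolutiveCT_mul_inv (mul_mem hp hx) hd').add
    (hasInvolutiveCT_mul_inv (mul_mem hp hy) hd)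

/-! ### Constant terms in several variables as operators on the ring -/

theorem exists_ct_mem_ellRing (ρ : MonOrder σ) (S : Set σ) {F : RatFun σ}
    (hF : F ∈ ellRing Set.univ) :
    ∃ G ∈ ellRing Set.univ, expand ρ G = ctSeries S (expand ρ F) := by
  induction S, S.toFinite using Set.Finite.induction_on with
  | empty => exact ⟨F, hF, (ctSeries_empty _).symm⟩
  | @insert v S _ _ ih =>
    obtain ⟨G, hG, h⟩ := ih
    obtain ⟨G', hG', -, -, h', -⟩ := hasInvolutiveCT_of_mem_ellRing ρ v hG
    exact ⟨G', hG', by rw [h', h, ctSeries_ctSeries, Set.singleton_union]⟩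

theorem hasRatCT_of_mem_ellRing (ρ : MonOrder σ) (S : Set σ) {F : RatFun σ}
    (hF : F ∈ ellRing Set.univ) : HasRatCT ρ S F := by
  obtain ⟨G, -, h⟩ := exists_ct_mem_ellRing ρ S hF
  exact ⟨G, h⟩

/-- Injectivity of `expand ρ` makes the chosen rational function unique, so rules for `ctSeries`
pass to `CT`. -/
theorem CT_eq_of_expand_eq {σ : Type} {ρ : MonOrder σ} {S : Set σ} {F G : RatFun σ}
    (h : expand ρ G = ctSeries S (expand ρ F)) : CT ρ S F = G := by
  have hF : HasRatCT ρ S F := ⟨G, h⟩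
  refine expand_injective ρ ?_
  rw [CT, dif_pos hF, hF.choose_spec, h]

theorem CT_mem_ellRing (ρ : MonOrder σ) (S : Set σ) {F : RatFun σ}
    (hF : F ∈ ellRing Set.univ) : CT ρ S F ∈ ellRing Set.univ := by
  obtain ⟨G, hG, h⟩ := exists_ct_mem_ellRing ρ S hF
  rwa [CT_eq_of_expand_eq h]

theorem expand_CT (ρ : MonOrder σ) (S : Set σ) {F : RatFun σ}
    (hF : F ∈ ellRing Set.univ) : expand ρ (CT ρ S F) = ctSeries S (expand ρ F) := by
  obtain ⟨G, hG, h⟩ := exists_ct_mem_ellRing ρ S hF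
  rw [CT_eq_of_expand_eq h, h]

theorem CT_empty {σ : Type} (ρ : MonOrder σ) (F : RatFun σ) : CT ρ ∅ F = F :=
  CT_eq_of_expand_eq (ctSeries_empty _).symm

theorem CT_add (ρ : MonOrder σ) (S : Set σ) {F F' : RatFun σ} (hF : F ∈ ellRing Set.univ)
    (hF' : F' ∈ ellRing Set.univ) : CT ρ S (F + F') = CT ρ S F + CT ρ S F' :=
  CT_eq_of_expand_eq (by rw [map_add, map_add, ctSeries_add, expand_CT ρ S hF, expand_CT ρ S hF'])

theorem CT_CT (ρ : MonOrder σ) (S T : Set σ) {F : RatFun σ} (hF : F ∈ ellRing Set.univ) :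
    CT ρ S (CT ρ T F) = CT ρ (S ∪ T) F := by
  refine CT_eq_of_expand_eq ?_
  rw [expand_CT ρ _ hF, expand_CT ρ _ hF, ctSeries_ctSeries]

theorem invCT_eq (ρ : MonOrder σ) (v : σ) {F : RatFun σ} (hF : F ∈ ellRing Set.univ) :
    invCT v F = CT ρ.rev {v} F + CT ρ {v} F := by
  obtain ⟨G, -, G', -, h, h', e⟩ := hasInvolutiveCT_of_mem_ellRing ρ v hF
  rw [e, CT_eq_of_expand_eq h, CT_eq_of_expand_eq h']

theorem algebraMap_mem_ellRing (p : MvPolynomial σ ℂ) :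
    algebraMap (MvPolynomial σ ℂ) (RatFun σ) p ∈ ellRing Set.univ := by
  classical
  induction p using MvPolynomial.induction_on with
  | C c => exact C_mem_ellRing _ c
  | add p q hp hq =>
    rw [map_add]
    exact add_mem hp hq
  | mul_X p w hp =>
    have hX : algebraMap (MvPolynomial σ ℂ) (RatFun σ) (MvPolynomial.X w) =
        laurentMonomial (Pi.single w 1) := by
      unfold laurentMonomial
      rw [Finset.prod_eq_single w]
      · rw [Pi.single_eq_same, zpow_one]
      · intro u _ hu
        rw [Pi.single_eq_of_ne hu, zpow_zero]
      · simp
    rw [map_mul, hX]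
    exact mul_mem hp (laurentMonomial_mem_ellRing (Set.mem_univ _))

theorem IsElliottRational.mem_ellRing {F : RatFun σ} (hF : IsElliottRational F) :
    F ∈ ellRing Set.univ := by
  obtain ⟨p, m, y, z, -, rfl⟩ := hF
  rw [div_eq_mul_inv, ← Finset.prod_inv_distrib]
  refine mul_mem (algebraMap_mem_ellRing p) (prod_mem fun i _ => ?_)
  have h : laurentMonomial (y i) - laurentMonomial (z i) =
      laurentMonomial (y i) * (1 - laurentMonomial (z i - y i)) := by
    rw [mul_sub, mul_one, ← laurentMonomial_add, add_sub_cancel]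
  rw [h, mul_inv, ← laurentMonomial_neg]
  exact mul_mem (laurentMonomial_mem_ellRing (Set.mem_univ _))
    (inv_one_sub_mem_ellRing (Set.mem_univ _))

end MalcevNeumann

/-! ### The telescoping sum -/

open MalcevNeumann in
theorem mainTheorem2 (r n : ℕ) (ρ : MalcevNeumann.MonOrder (Fin r ⊕ Fin n))
    (F : MalcevNeumann.RatFun (Fin r ⊕ Fin n)) (hF : MalcevNeumann.IsElliottRational F) :
    (MalcevNeumann.HasRatCT ρ (MalcevNeumann.lambdaVars n Set.univ) F ∧
      MalcevNeumann.HasRatCT ρ.rev (MalcevNeumann.lambdaVars n Set.univ) F ∧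
      ∀ i : Fin r,
        MalcevNeumann.HasRatCT ρ (MalcevNeumann.lambdaVars n (Set.Iio i)) F ∧
        MalcevNeumann.HasRatCT ρ.rev (MalcevNeumann.lambdaVars n (Set.Ioi i))
          (MalcevNeumann.invCT (Sum.inl i)
            (MalcevNeumann.CT ρ (MalcevNeumann.lambdaVars n (Set.Iio i)) F))) ∧
    MalcevNeumann.CT ρ.rev (MalcevNeumann.lambdaVars n Set.univ) F =
      (-1) ^ r * MalcevNeumann.CT ρ (MalcevNeumann.lambdaVars n Set.univ) F +
        ∑ i : Fin r, (-1) ^ (i : ℕ) *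
          MalcevNeumann.CT ρ.rev (MalcevNeumann.lambdaVars n (Set.Ioi i))
            (MalcevNeumann.invCT (Sum.inl i)
              (MalcevNeumann.CT ρ (MalcevNeumann.lambdaVars n (Set.Iio i)) F)) := by
  replace hF := hF.mem_ellRing
  have hmem : ∀ i : Fin r,
      invCT (Sum.inl i) (CT ρ (lambdaVars n (Set.Iio i)) F) ∈ ellRing Set.univ := by
    intro i
    rw [invCT_eq ρ _ (CT_mem_ellRing ρ _ hF)]
    exact add_mem (CT_mem_ellRing _ _ (CT_mem_ellRing ρ _ hF))
      (CT_mem_ellRing _ _ (CT_mem_ellRing ρ _ hF))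
  refine ⟨⟨hasRatCT_of_mem_ellRing _ _ hF, hasRatCT_of_mem_ellRing _ _ hF, fun i =>
    ⟨hasRatCT_of_mem_ellRing _ _ hF, hasRatCT_of_mem_ellRing _ _ (hmem i)⟩⟩, ?_⟩
  -- `T k` treats the first `k` variables by `ρ` and the others by the reversed order. A natural
  -- number `k` allows `k = r`, so both pure constant terms occur, as `T 0` and `T r`.
  set T : ℕ → RatFun (Fin r ⊕ Fin n) := fun k =>
    CT ρ.rev (lambdaVars n {j | k ≤ j}) (CT ρ (lambdaVars n {j | j < k}) F) with hT
  have hstep : ∀ i : Fin r, CT ρ.rev (lambdaVars n (Set.Ioi i))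
      (invCT (Sum.inl i) (CT ρ (lambdaVars n (Set.Iio i)) F)) = T i + T (i + 1) := by
    intro i
    have hG := CT_mem_ellRing ρ (lambdaVars n (Set.Iio i)) hF
    have h1 : lambdaVars n (Set.Ioi i) ∪ {Sum.inl i} = lambdaVars n {j | (i : ℕ) ≤ j} := by
      rw [lambdaVars, lambdaVars, ← Set.image_singleton, ← Set.image_union]
      congr 1
      ext j
      simp
    have h2 : {Sum.inl i} ∪ lambdaVars n (Set.Iio i) = lambdaVars n {j | (j : ℕ) < i + 1} := by
      rw [lambdaVars, lambdaVars, ← Set.image_singleton, ← Set.image_union]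
      congr 1
      ext j
      simp
    -- In the two parts of `invCT`, the variable `i` joins the later variables under the reversed
    -- order, giving `T i`, or the earlier ones under `ρ`, giving `T (i + 1)`.
    rw [invCT_eq ρ _ hG, CT_add _ _ (CT_mem_ellRing _ _ hG) (CT_mem_ellRing _ _ hG),
      CT_CT _ _ _ hG, CT_CT _ _ _ hF, h1, h2]
    rfl
  have htele : ∀ k : ℕ, T 0 = (-1) ^ k * T k +
      ∑ i ∈ Finset.range k, (-1) ^ i * (T i + T (i + 1)) := by
    intro k
    induction k with
    | zero => simp
    | succ k ih =>
      rw [Finset.sum_range_succ, pow_succ]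
      linear_combination ih
  have hT0 : T 0 = CT ρ.rev (lambdaVars n Set.univ) F := by
    simp [hT, lambdaVars, CT_empty]
  have hTr : T r = CT ρ (lambdaVars n Set.univ) F := by
    have h1 : {j : Fin r | r ≤ (j : ℕ)} = ∅ := by
      ext j
      simp
    simp [hT, lambdaVars, CT_empty, h1]
  rw [← hT0, ← hTr, htele r, Finset.sum_range]
  simp only [hstep]
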